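/- **Conventions.** A system of $N$ modes has phase space $\mathbb{R}^{2N}$ with coordinates $(x_1,p_1,\dots,x_N,p_N)$ and symplectic matrix $\sigma=\bigoplus_{i=1}^N\begin{pmatrix}0&1\\-1&0\end{pmatrix}$. The covariance matrices of its (Gaussian) states are the real symmetric $2N\times 2N$ matrices $\gamma$ with $\gamma\ge 0$ and $\gamma\pm i\sigma\ge 0$. For a bipartite system $A|B$ with $N=N_A+N_B$ modes, a covariance matrix $\gamma$ is *separable* if $\gamma\ge\gamma_A\oplus\gamma_B$ for some covariance matrices $\gamma_A,\gamma_B$ of $N_A$ and $N_B$ modes, and *entangled* otherwise. An *entanglement witness* is a real symmetric $2N\times2N$ matrix $Z$ with $\operatorname{tr}[Z\gamma']\ge 1$ for all separable covariance matrices $\gamma'$. Put $\gamma^{T_A}=(M_A\oplus 1_B)\,\gamma\,(M_A\oplus 1_B)$ with $M_A=\bigoplus_{i=1}^{N_A}\operatorname{diag}(1,-1)$, and let $\gamma^{T_A}_1,\dots,\gamma^{T_A}_N$ be its symplectic eigenvalues, i.e. the positive eigenvalues of $i\sigma\gamma^{T_A}$ with multiplicity. The logarithmic negativity of $\gamma$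 is $E_{\mathcal N}(\gamma)=-\sum_i\min(\ln\gamma^{T_A}_i,0)$. The *PPT criterion is necessary and sufficient* for $N_A\times N_B$ modes if every covariance matrix $\gamma$ of the system is separable if and only if $\gamma^{T_A}+i\sigma\ge 0$. **Statement.** 1. Suppose that the PPT criterion is necessary and sufficient for $N_A\times N_B$ modes. If $\gamma$ is a covariance matrix of this system and some entanglement witness $Z$ gives $\operatorname{tr}[Z\gamma]=m\in(0,1)$, then $E_{\mathcal N}(\gamma)\ge\ln\frac1m$. 2. For $1\times N_B$ modes, with any $N_B$, the conclusion of 1 holds without further assumption. 3. Let $\gamma$ be a covariance matrix of a two-mode ($1\times 1$) system. At most one symplectic eigenvalue of $\gamma^{T_A}$ (counted with multiplicity) is smaller than one, and the minimum $m_{\min}=\min_Z\operatorname{tr}[Z\gamma]$ over all entanglement witnesses $Z$ exists. If $\gamma$ is entangled, then $m_{\min}\in(0,1)$, $m_{\min}$ is the smallest symplectic eigenvalue of $\gamma^{T_A}$, and $E_{\mathcal N}(\gamma)=\ln\frac1{m_{\min}}$. -/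

import Mathlib

open scoped Kronecker ComplexOrder

noncomputable section

namespace GaussianWitness

/-- The phase-space coordinates of `N` modes: `(k, 0)` is the position and `(k, 1)` the momentum
of mode `k`, so that the canonical vector is `(x₁, p₁, …, x_N, p_N)`. -/
abbrev Coord (N : ℕ) : Type := Fin N × Fin 2

/-- The phase-space coordinates of a bipartite system with `NA + NB` modes. -/
abbrev BiCoord (NA NB : ℕ) : Type := Coord NA ⊕ Coord NB

/-- Direct sum of a matrix of party `A` and a matrix of party `B`. -/
def directSum {NA NB : ℕ} (X : Matrix (Coord NA) (Coord NA) ℝ)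
    (Y : Matrix (Coord NB) (Coord NB) ℝ) : Matrix (BiCoord NA NB) (BiCoord NA NB) ℝ :=
  Matrix.fromBlocks X 0 0 Y

/-- The symplectic matrix of `N` modes, `⨁ₖ (0 1; -1 0)`. -/
def sympl (N : ℕ) : Matrix (Coord N) (Coord N) ℝ :=
  (1 : Matrix (Fin N) (Fin N) ℝ) ⊗ₖ !![0, 1; -1, 0]

/-- The symplectic matrix of the bipartite system. -/
def biSympl (NA NB : ℕ) : Matrix (BiCoord NA NB) (BiCoord NA NB) ℝ :=
  directSum (sympl NA) (sympl NB)

/-- A real matrix seen as a complex one. -/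
def toC {n : Type} (A : Matrix n n ℝ) : Matrix n n ℂ := A.map Complex.ofReal

/-- `γ` is a covariance matrix for the symplectic form `σ`:
real symmetric, `γ ≥ 0` and `γ ± iσ ≥ 0`. -/
structure IsCM {n : Type} (σ γ : Matrix n n ℝ) : Prop where
  symm : γ.IsSymm
  nonneg : γ.PosSemidef
  uncertainty_pos : (toC γ + Complex.I • toC σ).PosSemidef
  uncertainty_neg : (toC γ - Complex.I • toC σ).PosSemidef

/-- Covariance matrices of the bipartite system. -/
def CMSet (NA NB : ℕ) : Set (Matrix (BiCoord NA NB) (BiCoord NA NB) ℝ) :=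
  {γ | IsCM (biSympl NA NB) γ}

/-- Covariance matrices that are separable with respect to the split `A|B`:
`γ ≥ γA ⊕ γB` for covariance matrices `γA`, `γB` of the two parties. -/
def SepCMSet (NA NB : ℕ) : Set (Matrix (BiCoord NA NB) (BiCoord NA NB) ℝ) :=
  {γ | γ ∈ CMSet NA NB ∧
    ∃ (γA : Matrix (Coord NA) (Coord NA) ℝ) (γB : Matrix (Coord NB) (Coord NB) ℝ),
      IsCM (sympl NA) γA ∧ IsCM (sympl NB) γB ∧ (γ - directSum γA γB).PosSemidef}

/-- Entanglement witnesses for the split `A|B`: real symmetric matrices `Z` with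
`tr[γ Z] ≥ 1` for every separable covariance matrix `γ`. -/
def witnesses (NA NB : ℕ) : Set (Matrix (BiCoord NA NB) (BiCoord NA NB) ℝ) :=
  {Z | Z.IsSymm ∧ ∀ γ ∈ SepCMSet NA NB, 1 ≤ (γ * Z).trace}

/-- The outcomes `tr[Z γ]` of all entanglement witnesses `Z` on `γ`. -/
def outcomes {NA NB : ℕ} (γ : Matrix (BiCoord NA NB) (BiCoord NA NB) ℝ) : Set ℝ :=
  {m | ∃ Z ∈ witnesses NA NB, m = (Z * γ).trace}

/-- `M = ⨁ₖ diag(1, -1)`, the reversal of all momenta. -/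
def momentumFlip (N : ℕ) : Matrix (Coord N) (Coord N) ℝ :=
  (1 : Matrix (Fin N) (Fin N) ℝ) ⊗ₖ !![1, 0; 0, -1]

/-- The partially transposed covariance matrix `(M_A ⊕ 1) γ (M_A ⊕ 1)`. -/
def partialTranspose {NA NB : ℕ} (γ : Matrix (BiCoord NA NB) (BiCoord NA NB) ℝ) :
    Matrix (BiCoord NA NB) (BiCoord NA NB) ℝ :=
  directSum (momentumFlip NA) 1 * γ * directSum (momentumFlip NA) 1

open Classical in
/-- The symplectic eigenvalues of `A` with respect to `σ`: the positive eigenvalues of `i σ A`,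
with multiplicity. For a positive definite `A` on `N` modes these are `N` numbers, the entries
`a₁, …, a_N` of the Williamson normal form `S A Sᵀ = diag(a₁, a₁, …, a_N, a_N)`. -/
def symplEigenvalues {n : Type} [Fintype n] [DecidableEq n] (σ A : Matrix n n ℝ) : Multiset ℝ :=
  ((Complex.I • toC (σ * A)).charpoly.roots.filter (fun z => 0 < z)).map Complex.re

/-- The symplectic eigenvalues of the partially transposed covariance matrix. -/
def ptEigenvalues {NA NB : ℕ} (γ : Matrix (BiCoord NA NB) (BiCoord NA NB) ℝ) : Multiset ℝ :=
  symplEigenvalues (biSympl NA NB) (partialTranspose γ)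

/-- The logarithmic negativity `E_N(γ) = - ∑ᵢ min (ln γᵢ^{T_A}, 0)` of a covariance matrix. -/
def logNegativity {NA NB : ℕ} (γ : Matrix (BiCoord NA NB) (BiCoord NA NB) ℝ) : ℝ :=
  -((ptEigenvalues γ).map (fun x => min (Real.log x) 0)).sum

/-- The PPT criterion is necessary and sufficient for separability of covariance matrices of
`NA × NB` modes. -/
def PPTNecessaryAndSufficient (NA NB : ℕ) : Prop :=
  ∀ γ ∈ CMSet NA NB, γ ∈ SepCMSet NA NB ↔
    (toC (partialTranspose γ) + Complex.I • toC (biSympl NA NB)).PosSemidef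

end GaussianWitness

end

/-! The whole argument rests on dilations. Let s be at most every symplectic eigenvalue of γ and of
its partial transpose. Then γ/s is again a covariance matrix and its partial transpose satisfies the
uncertainty relation, so the PPT criterion makes γ/s separable, and every witness gives tr[Zγ] ≥ s
(`le_outcome`). The eigenvalues of γ itself are at least 1, so an outcome m < 1 forces an eigenvalue
x ≤ m of the partial transpose; its term alone contributes -ln x ≥ ln(1/m) to the negativity, and
the other terms are nonnegative.

For one mode against `NB`, the criterion is proved by two Schur complements. Eliminating B leaves a
Hermitian one-mode matrix dominating both iσ and -iσ, which lies above a real covariance matrix γA;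
eliminating A then yields γB. Invertibility is bought by dilating γ by t > 1, and compactness lets t
tend to 1.

The bound is attained: an eigenvector w of Aw = x iσw gives the witness Re(ww†)/(w†iσw), with
outcome x, both for A = γ and for A the partial transpose (`exists_vectorWitness`). For two modes,
partial transposition preserves the determinant, hence the product of the two symplectic
eigenvalues, which is at least 1. Only one factor can therefore drop below 1, and the negativity has
a single nonzero term when γ is entangled. -/

namespace GaussianWitness

open Matrix

/-! ### Uncertainty relation and symplectic eigenvalues -/

section General

variable {n : Type}

lemma toC_add (A B : Matrix n n ℝ) : toC (A + B) = toC A + toC B := by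
  ext; simp [toC]

lemma toC_sub (A B : Matrix n n ℝ) : toC (A - B) = toC A - toC B := by
  ext; simp [toC]

lemma toC_neg (A : Matrix n n ℝ) : toC (-A) = -toC A := by
  ext; simp [toC]

lemma toC_smul (t : ℝ) (A : Matrix n n ℝ) : toC (t • A) = t • toC A := by
  ext; simp [toC]

lemma toC_transpose (A : Matrix n n ℝ) : toC Aᵀ = (toC A)ᵀ := rfl

lemma toC_conjTranspose (A : Matrix n n ℝ) : (toC A)ᴴ = toC Aᵀ := by
  ext; simp [toC]

lemma toC_one [DecidableEq n] : toC (1 : Matrix n n ℝ) = 1 := by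
  ext i j; by_cases h : i = j <;> simp [toC, Matrix.one_apply, h]

lemma toC_mul [Fintype n] (A B : Matrix n n ℝ) : toC (A * B) = toC A * toC B := by
  ext; simp [toC, Matrix.mul_apply]

lemma I_smul_isHermitian {σ : Matrix n n ℝ} (hσ : σᵀ = -σ) :
    (Complex.I • toC σ).IsHermitian := by
  rw [IsHermitian, conjTranspose_smul, toC_conjTranspose, hσ, toC_neg]
  simp

lemma transpose_sub_I_smul {A σ : Matrix n n ℝ} (hA : A.IsSymm) (hσ : σᵀ = -σ) :
    (toC A - Complex.I • toC σ)ᵀ = toC A + Complex.I • toC σ := by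
  rw [transpose_sub, transpose_smul, ← toC_transpose, ← toC_transpose, hA.eq, hσ, toC_neg]
  simp

/-- Transposition preserves semidefiniteness and flips the sign of iσ, so only one of the two
uncertainty relations ever has to be checked. -/
lemma posSemidef_add_iff_sub {A σ : Matrix n n ℝ} (hA : A.IsSymm) (hσ : σᵀ = -σ) :
    (toC A + Complex.I • toC σ).PosSemidef ↔ (toC A - Complex.I • toC σ).PosSemidef := by
  rw [← transpose_sub_I_smul hA hσ, posSemidef_transpose_iff]

variable [Fintype n]

lemma posSemidef_toC {A : Matrix n n ℝ} (hA : A.PosSemidef) : (toC A).PosSemidef := by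
  classical
  open scoped MatrixOrder in
  obtain ⟨B, rfl⟩ := CStarAlgebra.nonneg_iff_eq_star_mul_self.mp hA.nonneg
  have : toC (star B * B) = (toC B)ᴴ * toC B := by
    rw [toC_mul, toC_conjTranspose, star_eq_conjTranspose, conjTranspose_eq_transpose_of_trivial]
  rw [this]
  exact posSemidef_conjTranspose_mul_self _

lemma star_dotProduct_toC (A : Matrix n n ℝ) (v : n → ℝ) :
    star (fun i => (v i : ℂ)) ⬝ᵥ (toC A *ᵥ fun i => (v i : ℂ)) = ((v ⬝ᵥ (A *ᵥ v) : ℝ) : ℂ) := by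
  simp [dotProduct, mulVec, toC]

lemma posSemidef_of_toC {A : Matrix n n ℝ} (hA : (toC A).PosSemidef) : A.PosSemidef := by
  refine .of_dotProduct_mulVec_nonneg ?_ fun v => ?_
  · ext i j
    have := congrFun (congrFun hA.1 i) j
    simpa [toC] using this
  · have := hA.dotProduct_mulVec_nonneg (fun i => (v i : ℂ))
    rw [star_dotProduct_toC] at this
    simpa using this

lemma IsCM.of_sub {σ γ : Matrix n n ℝ} (hσ : σᵀ = -σ) (hγ : γ.IsSymm)
    (h : (toC γ - Complex.I • toC σ).PosSemidef) : IsCM σ γ := by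
  have h' := (posSemidef_add_iff_sub hγ hσ).2 h
  refine ⟨hγ, ?_, h', h⟩
  -- γ is the average of γ + iσ and γ - iσ, so its positivity comes for free.
  have h2 := (h'.add h).smul (show (0 : ℝ) ≤ 1 / 2 by norm_num)
  apply posSemidef_of_toC
  convert h2 using 1
  ext i j
  simp
  ring

lemma IsCM.smul {σ γ : Matrix n n ℝ} (hσ : σᵀ = -σ) (h : IsCM σ γ) {t : ℝ} (ht : 1 ≤ t) :
    IsCM σ (t • γ) := by
  refine .of_sub hσ (h.symm.smul t) ?_
  have := h.uncertainty_neg.add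
    ((posSemidef_toC h.nonneg).smul (show (0 : ℝ) ≤ t - 1 by linarith))
  convert this using 1
  rw [toC_smul, sub_smul, one_smul]
  abel

lemma dotProduct_I_smul_im {σ : Matrix n n ℝ} (hσ : σᵀ = -σ) (w : n → ℂ) :
    ((star w ⬝ᵥ ((Complex.I • toC σ) *ᵥ w)).re : ℂ) = star w ⬝ᵥ ((Complex.I • toC σ) *ᵥ w) := by
  have := (I_smul_isHermitian hσ).im_star_dotProduct_mulVec_self w
  exact Complex.ext (by simp) (by simpa using this.symm)

variable [DecidableEq n]

/-- On a kernel vector of γ, both iσ and -iσ have nonnegative expectation, so the vector is also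
killed by γ + iσ, hence by the invertible σ. -/
lemma IsCM.posDef_toC {σ γ : Matrix n n ℝ} (hσ2 : σ * σ = -1) (h : IsCM σ γ) :
    (toC γ).PosDef := by
  have hps := posSemidef_toC h.nonneg
  refine .of_dotProduct_mulVec_pos hps.1 fun v hv => ?_
  refine lt_of_le_of_ne (hps.dotProduct_mulVec_nonneg v) fun h0 => hv ?_
  have hp := h.uncertainty_pos.dotProduct_mulVec_nonneg v
  have hm := h.uncertainty_neg.dotProduct_mulVec_nonneg v
  have h1 : toC γ *ᵥ v = 0 := (hps.dotProduct_mulVec_zero_iff v).1 h0.symm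
  have h2 : (toC γ + Complex.I • toC σ) *ᵥ v = 0 := by
    refine (h.uncertainty_pos.dotProduct_mulVec_zero_iff v).1 (le_antisymm ?_ hp)
    rw [sub_mulVec, h1, zero_sub, dotProduct_neg] at hm
    rw [add_mulVec, h1, zero_add]
    exact neg_nonneg.1 hm
  rw [add_mulVec, h1, zero_add, smul_mulVec] at h2
  have h3 : toC σ *ᵥ v = 0 := by simpa using h2
  have h4 : toC σ *ᵥ (toC σ *ᵥ v) = -v := by
    rw [mulVec_mulVec, ← toC_mul, hσ2, toC_neg, toC_one, neg_mulVec, one_mulVec]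
  rw [h3, mulVec_zero] at h4
  simpa using h4.symm

/-- Eigenvectors of `iσA` solve the generalised eigenvalue problem `A w = μ iσ w`. -/
lemma exists_eigenvector {σ A : Matrix n n ℝ} (hσ2 : σ * σ = -1) {μ : ℂ}
    (hμ : μ ∈ (Complex.I • toC (σ * A)).charpoly.roots) :
    ∃ w : n → ℂ, w ≠ 0 ∧ toC A *ᵥ w = μ • ((Complex.I • toC σ) *ᵥ w) := by
  have hroot := (Polynomial.mem_roots'.1 hμ).2
  rw [Polynomial.IsRoot, eval_charpoly] at hroot
  obtain ⟨w, hw, h⟩ := exists_mulVec_eq_zero_iff.2 hroot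
  refine ⟨w, hw, ?_⟩
  rw [sub_mulVec, sub_eq_zero] at h
  have h1 : (scalar n μ) *ᵥ w = μ • w := by
    ext i; simp [mulVec_diagonal]
  rw [h1, toC_mul] at h
  have h2 := congrArg (fun u => (Complex.I • toC σ) *ᵥ u) h
  have h3 : (Complex.I • toC σ) * (Complex.I • (toC σ * toC A)) = toC A := by
    rw [smul_mul_smul_comm, ← Matrix.mul_assoc, ← toC_mul σ σ, hσ2, toC_neg, toC_one]
    simp
  simp only [mulVec_mulVec, h3, mulVec_smul] at h2
  exact h2.symm

lemma mem_roots_of_eigenvector {σ A : Matrix n n ℝ} (hσ2 : σ * σ = -1) {μ : ℂ} {w : n → ℂ}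
    (hw : w ≠ 0) (h : toC A *ᵥ w = μ • ((Complex.I • toC σ) *ᵥ w)) :
    μ ∈ (Complex.I • toC (σ * A)).charpoly.roots := by
  rw [Polynomial.mem_roots (charpoly_monic _).ne_zero, Polynomial.IsRoot, eval_charpoly]
  refine exists_mulVec_eq_zero_iff.1 ⟨w, hw, ?_⟩
  have h1 : (scalar n μ) *ᵥ w = μ • w := by
    ext i; simp [mulVec_diagonal]
  have h3 : (Complex.I • toC σ) * (Complex.I • toC σ) = 1 := by
    rw [smul_mul_smul_comm, ← toC_mul σ σ, hσ2, toC_neg, toC_one]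
    simp
  rw [sub_mulVec, sub_eq_zero, h1, toC_mul, ← smul_mul_assoc, ← mulVec_mulVec, h, mulVec_smul,
    mulVec_mulVec, h3, one_mulVec]

/-- The roots of the characteristic polynomial of `iσA` are real and nonzero, and a quadratic form
identity holds on eigenvectors. -/
lemma root_real {σ A : Matrix n n ℝ} (hσ : σᵀ = -σ) (hσ2 : σ * σ = -1) (hA : (toC A).PosDef)
    {μ : ℂ} (hμ : μ ∈ (Complex.I • toC (σ * A)).charpoly.roots) :
    ∃ x : ℝ, μ = x ∧ x ≠ 0 ∧ ∃ (w : n → ℂ) (c : ℝ),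
      star w ⬝ᵥ ((Complex.I • toC σ) *ᵥ w) = c ∧ 0 < x * c ∧
      star w ⬝ᵥ (toC A *ᵥ w) = ((x * c : ℝ) : ℂ) := by
  obtain ⟨w, hw, h⟩ := exists_eigenvector hσ2 hμ
  have hc := dotProduct_I_smul_im hσ w
  set c := (star w ⬝ᵥ ((Complex.I • toC σ) *ᵥ w)).re with hcdef
  have hpos := hA.dotProduct_mulVec_pos hw
  have heq : star w ⬝ᵥ (toC A *ᵥ w) = μ * c := by
    rw [h, dotProduct_smul, smul_eq_mul, hc]
  rw [heq] at hpos
  obtain ⟨hre, him⟩ := Complex.pos_iff.1 hpos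
  simp at hre him
  have hc0 : c ≠ 0 := by rintro h0; simp [h0] at hre
  have him' : μ.im = 0 := by tauto
  have hμr : μ = (μ.re : ℂ) := Complex.ext rfl (by simpa using him')
  refine ⟨μ.re, hμr, ?_, w, c, hc.symm, hre, ?_⟩
  · rintro h0; simp [h0] at hre
  · rw [heq, Complex.ofReal_mul, ← hμr]

lemma mem_symplEigenvalues_iff {σ A : Matrix n n ℝ} {x : ℝ} :
    x ∈ symplEigenvalues σ A ↔ 0 < x ∧ (x : ℂ) ∈ (Complex.I • toC (σ * A)).charpoly.roots := by
  simp only [symplEigenvalues, Multiset.mem_map, Multiset.mem_filter]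
  constructor
  · rintro ⟨z, ⟨hz, hz0⟩, rfl⟩
    obtain ⟨hre, him⟩ := Complex.pos_iff.1 hz0
    have : ((z.re : ℝ) : ℂ) = z := Complex.ext rfl (by simpa using him)
    exact ⟨hre, this.symm ▸ hz⟩
  · rintro ⟨hx, h⟩
    exact ⟨x, ⟨h, by simpa using hx⟩, by simp⟩

lemma symplEigenvalue_vector {σ A : Matrix n n ℝ} (hσ : σᵀ = -σ) (hσ2 : σ * σ = -1)
    (hA : (toC A).PosDef) {x : ℝ} (hx : x ∈ symplEigenvalues σ A) :
    ∃ (w : n → ℂ) (c : ℝ), 0 < c ∧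
      star w ⬝ᵥ ((Complex.I • toC σ) *ᵥ w) = c ∧
      star w ⬝ᵥ (toC A *ᵥ w) = ((x * c : ℝ) : ℂ) := by
  obtain ⟨hx0, hx⟩ := mem_symplEigenvalues_iff.1 hx
  obtain ⟨y, hy, -, w, c, h1, h2, h3⟩ := root_real hσ hσ2 hA hx
  have : x = y := by exact_mod_cast hy
  subst this
  exact ⟨w, c, pos_of_mul_pos_right h2 hx0.le, h1, h3⟩

/-- The uncertainty relation bounds the symplectic eigenvalues from below. -/
lemma one_le_symplEigenvalue {σ A : Matrix n n ℝ} (hσ : σᵀ = -σ) (hσ2 : σ * σ = -1)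
    (hA : IsCM σ A) {x : ℝ} (hx : x ∈ symplEigenvalues σ A) : 1 ≤ x := by
  obtain ⟨w, c, hc, h1, h2⟩ := symplEigenvalue_vector hσ hσ2 (hA.posDef_toC hσ2) hx
  have h := hA.uncertainty_neg.dotProduct_mulVec_nonneg w
  rw [sub_mulVec, dotProduct_sub, h1, h2, ← Complex.ofReal_sub] at h
  have h' : 0 ≤ x * c - c := by exact_mod_cast h
  by_contra hlt
  nlinarith [not_le.1 hlt]

/-- Lower bounds on the symplectic eigenvalues give the (rescaled) uncertainty relation. -/
lemma posSemidef_of_symplEigenvalues {σ A : Matrix n n ℝ} (hσ : σᵀ = -σ) (hσ2 : σ * σ = -1)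
    (hA : (toC A).PosDef) {s : ℝ} (hs : 0 < s) (h : ∀ x ∈ symplEigenvalues σ A, s ≤ x) :
    (toC (s⁻¹ • A) - Complex.I • toC σ).PosSemidef := by
  open scoped MatrixOrder in
  obtain ⟨B, hB⟩ := CStarAlgebra.nonneg_iff_eq_star_mul_self.mp hA.posSemidef.nonneg
  rw [star_eq_conjTranspose] at hB
  have hBu : IsUnit B := by
    have := hA.isUnit
    rw [hB, isUnit_iff_isUnit_det, det_mul] at this
    exact (isUnit_iff_isUnit_det _).2 (isUnit_of_mul_isUnit_right this)
  have hBd : IsUnit B.det := (isUnit_iff_isUnit_det _).1 hBu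
  set J : Matrix n n ℂ := Complex.I • toC σ with hJ
  have hJH : J.IsHermitian := I_smul_isHermitian hσ
  -- With A = B†B, congruence by B⁻¹ turns the claim into positivity of K.
  set K : Matrix n n ℂ := (s⁻¹ : ℝ) • 1 - B⁻¹ᴴ * J * B⁻¹ with hK
  have hKH : K.IsHermitian := by
    refine IsHermitian.sub ?_ (isHermitian_conjTranspose_mul_mul _ hJH)
    rw [IsHermitian, conjTranspose_smul]; simp
  have hBH : Bᴴ * B⁻¹ᴴ = 1 := by
    rw [← conjTranspose_mul, nonsing_inv_mul _ hBd, conjTranspose_one]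
  have hconj : toC (s⁻¹ • A) - J = Bᴴ * K * B := by
    rw [hK, Matrix.mul_sub, Matrix.sub_mul, toC_smul, hB]
    congr 1
    · simp
    · calc J = (Bᴴ * B⁻¹ᴴ) * J * (B⁻¹ * B) := by
            rw [hBH, nonsing_inv_mul _ hBd, Matrix.one_mul, Matrix.mul_one]
        _ = _ := by simp only [Matrix.mul_assoc]
  rw [hconj]
  refine PosSemidef.conjTranspose_mul_mul_same ?_ B
  rw [hKH.posSemidef_iff_eigenvalues_nonneg]
  intro i
  by_contra hneg
  simp only [Pi.zero_apply, not_le] at hneg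
  set τ := hKH.eigenvalues i with hτ
  set u : n → ℂ := ⇑(hKH.eigenvectorBasis i) with hu
  have hu0 : u ≠ 0 := by
    intro h0
    have := hKH.eigenvectorBasis.orthonormal.ne_zero i
    exact this (by ext j; simpa using congrFun h0 j)
  have hKu : K *ᵥ u = τ • u := hKH.mulVec_eigenvectorBasis i
  -- A negative eigenvalue τ of K is an eigenvalue κ > 1/s of B⁻†JB⁻¹; pulled back by B⁻¹ it
  -- exhibits the symplectic eigenvalue 1/κ < s, a contradiction.
  set κ : ℝ := s⁻¹ - τ with hκ
  have hκpos : s⁻¹ < κ := by linarith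
  have hκ0 : 0 < κ := (inv_pos.2 hs).trans hκpos
  have h1 : (B⁻¹ᴴ * J * B⁻¹) *ᵥ u = κ • u := by
    rw [hK, sub_mulVec, smul_mulVec, one_mulVec] at hKu
    rw [hκ, sub_smul, ← hKu]
    abel
  set w := B⁻¹ *ᵥ u with hw
  have hBw : B *ᵥ w = u := by
    rw [hw, mulVec_mulVec, mul_nonsing_inv _ hBd, one_mulVec]
  have hw0 : w ≠ 0 := by
    intro h0; rw [h0, mulVec_zero] at hBw; exact hu0 hBw.symm
  have h2 : J *ᵥ w = κ • (toC A *ᵥ w) := by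
    have := congrArg (fun z => Bᴴ *ᵥ z) h1
    simp only [mulVec_smul, mulVec_mulVec] at this
    rw [← Matrix.mul_assoc, ← Matrix.mul_assoc, hBH, Matrix.one_mul, ← mulVec_mulVec] at this
    rw [hw, this, hB, ← mulVec_mulVec, hBw]
  have h3 : toC A *ᵥ w = ((κ⁻¹ : ℝ) : ℂ) • (J *ᵥ w) := by
    rw [h2, Complex.coe_smul, smul_smul, inv_mul_cancel₀ hκ0.ne', one_smul]
  have h4 := h κ⁻¹ (mem_symplEigenvalues_iff.2
    ⟨inv_pos.2 hκ0, mem_roots_of_eigenvector hσ2 hw0 h3⟩)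
  have := (inv_lt_inv₀ hκ0 (inv_pos.2 hs)).2 hκpos
  rw [inv_inv] at this
  linarith

end General

end GaussianWitness

namespace GaussianWitness

open Matrix

/-! ### Witnesses built from eigenvectors -/

section Witness

variable {n : Type} [Fintype n]

/-- The real part of the rank one operator `w w†`, divided by `c`. -/
noncomputable def vectorWitness (w : n → ℂ) (c : ℝ) : Matrix n n ℝ :=
  Matrix.of fun i j => (star (w i) * w j).re / c

omit [Fintype n] in
lemma vectorWitness_isSymm (w : n → ℂ) (c : ℝ) : (vectorWitness w c).IsSymm := by
  ext i j
  simp only [vectorWitness, transpose_apply, of_apply]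
  congr 1
  simp
  ring

lemma trace_mul_vectorWitness (A : Matrix n n ℝ) (w : n → ℂ) (c : ℝ) :
    (A * vectorWitness w c).trace = (star w ⬝ᵥ (toC A *ᵥ w)).re / c := by
  simp only [trace, diag_apply, mul_apply, vectorWitness, of_apply, dotProduct, mulVec,
    Complex.re_sum, Finset.sum_div, Finset.mul_sum]
  refine Finset.sum_congr rfl fun i _ => Finset.sum_congr rfl fun j _ => ?_
  simp [toC]
  ring

variable [DecidableEq n]

/-- Testing B ≥ iσ on the eigenvector w gives w†Bw ≥ w†iσw = c > 0, with w†Aw = xc; dividing by c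
normalises the bound to 1. -/
lemma exists_vectorWitness {σ A : Matrix n n ℝ} (hσ : σᵀ = -σ) (hσ2 : σ * σ = -1)
    (hA : (toC A).PosDef) {x : ℝ} (hx : x ∈ symplEigenvalues σ A) :
    ∃ Z : Matrix n n ℝ, Z.IsSymm ∧ (A * Z).trace = x ∧
      ∀ B : Matrix n n ℝ, (toC B - Complex.I • toC σ).PosSemidef → 1 ≤ (B * Z).trace := by
  obtain ⟨w, c, hc, h1, h2⟩ := symplEigenvalue_vector hσ hσ2 hA hx
  refine ⟨vectorWitness w c, vectorWitness_isSymm w c, ?_, fun B hB => ?_⟩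
  · rw [trace_mul_vectorWitness, h2, Complex.ofReal_re, mul_div_cancel_right₀ _ hc.ne']
  · have h := hB.re_dotProduct_nonneg w
    rw [sub_mulVec, dotProduct_sub, h1] at h
    rw [trace_mul_vectorWitness, one_le_div hc]
    simpa using h

end Witness

/-! ### Partial transposition and the necessity of PPT -/

section Bipartite

lemma sympl_transpose (N : ℕ) : (sympl N)ᵀ = -sympl N := by
  ext ⟨i, a⟩ ⟨j, b⟩
  fin_cases a <;> fin_cases b <;> simp [sympl, Matrix.one_apply, eq_comm]

lemma sympl_mul_self (N : ℕ) : sympl N * sympl N = -1 := by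
  rw [sympl, ← mul_kronecker_mul, Matrix.one_mul]
  have : (!![0, 1; -1, 0] : Matrix (Fin 2) (Fin 2) ℝ) * !![0, 1; -1, 0] = -1 := by
    ext i j; fin_cases i <;> fin_cases j <;> simp
  rw [this, ← neg_one_smul ℝ (1 : Matrix (Fin 2) (Fin 2) ℝ), kronecker_smul, one_kronecker_one,
    neg_one_smul]

lemma momentumFlip_transpose (N : ℕ) : (momentumFlip N)ᵀ = momentumFlip N := by
  ext ⟨i, a⟩ ⟨j, b⟩
  fin_cases a <;> fin_cases b <;> simp [momentumFlip, Matrix.one_apply, eq_comm]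

lemma momentumFlip_mul_self (N : ℕ) : momentumFlip N * momentumFlip N = 1 := by
  rw [momentumFlip, ← mul_kronecker_mul, Matrix.one_mul]
  have : (!![1, 0; 0, -1] : Matrix (Fin 2) (Fin 2) ℝ) * !![1, 0; 0, -1] = 1 := by
    ext i j; fin_cases i <;> fin_cases j <;> simp
  rw [this, one_kronecker_one]

lemma momentumFlip_conj_sympl (N : ℕ) :
    momentumFlip N * sympl N * momentumFlip N = -sympl N := by
  rw [momentumFlip, sympl, ← mul_kronecker_mul, ← mul_kronecker_mul, Matrix.one_mul,
    Matrix.one_mul]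
  have : (!![1, 0; 0, -1] : Matrix (Fin 2) (Fin 2) ℝ) * !![0, 1; -1, 0] * !![1, 0; 0, -1]
      = (-1 : ℝ) • !![0, 1; -1, 0] := by
    ext i j; fin_cases i <;> fin_cases j <;> simp
  rw [this, kronecker_smul, neg_one_smul]

lemma det_sympl (N : ℕ) : (sympl N).det = 1 := by
  simp [sympl, det_kronecker, det_fin_two]

variable {NA NB : ℕ}

lemma biSympl_transpose : (biSympl NA NB)ᵀ = -biSympl NA NB := by
  rw [biSympl, directSum, fromBlocks_transpose, sympl_transpose, sympl_transpose, fromBlocks_neg]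
  simp

lemma biSympl_mul_self : biSympl NA NB * biSympl NA NB = -1 := by
  rw [biSympl, directSum, fromBlocks_multiply, sympl_mul_self, sympl_mul_self, ← fromBlocks_one,
    fromBlocks_neg]
  simp

lemma det_biSympl : (biSympl NA NB).det = 1 := by
  rw [biSympl, directSum, det_fromBlocks_zero₂₁, det_sympl, det_sympl, one_mul]

/-- The matrix `M_A ⊕ 1_B` of the partial transposition. -/
abbrev ptMatrix (NA NB : ℕ) : Matrix (BiCoord NA NB) (BiCoord NA NB) ℝ :=
  directSum (momentumFlip NA) 1

lemma ptMatrix_transpose : (ptMatrix NA NB)ᵀ = ptMatrix NA NB := by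
  simp [ptMatrix, directSum, fromBlocks_transpose, momentumFlip_transpose]

lemma ptMatrix_mul_self : ptMatrix NA NB * ptMatrix NA NB = 1 := by
  simp [ptMatrix, directSum, fromBlocks_multiply, momentumFlip_mul_self]

lemma ptMatrix_conj_biSympl :
    ptMatrix NA NB * biSympl NA NB * ptMatrix NA NB = directSum (-sympl NA) (sympl NB) := by
  simp [ptMatrix, directSum, biSympl, fromBlocks_multiply, momentumFlip_conj_sympl]

lemma partialTranspose_isSymm {γ : Matrix (BiCoord NA NB) (BiCoord NA NB) ℝ} (h : γ.IsSymm) :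
    (partialTranspose γ).IsSymm := by
  rw [IsSymm, partialTranspose, transpose_mul, transpose_mul, ptMatrix_transpose, h.eq,
    Matrix.mul_assoc]

lemma partialTranspose_smul (t : ℝ) (γ : Matrix (BiCoord NA NB) (BiCoord NA NB) ℝ) :
    partialTranspose (t • γ) = t • partialTranspose γ := by
  simp [partialTranspose]

lemma det_partialTranspose (γ : Matrix (BiCoord NA NB) (BiCoord NA NB) ℝ) :
    (partialTranspose γ).det = γ.det := by
  have h : (ptMatrix NA NB).det * (ptMatrix NA NB).det = 1 := by
    rw [← det_mul, ptMatrix_mul_self, det_one]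
  rw [partialTranspose, det_mul, det_mul, mul_right_comm, h, one_mul]

lemma toC_ptMatrix_conjTranspose : (toC (ptMatrix NA NB))ᴴ = toC (ptMatrix NA NB) := by
  rw [toC_conjTranspose, ptMatrix_transpose]

lemma partialTranspose_posDef {γ : Matrix (BiCoord NA NB) (BiCoord NA NB) ℝ}
    (h : (toC γ).PosDef) : (toC (partialTranspose γ)).PosDef := by
  rw [partialTranspose, toC_mul, toC_mul]
  nth_rewrite 1 [← toC_ptMatrix_conjTranspose]
  refine h.conjTranspose_mul_mul_same ?_
  have h1 : toC (ptMatrix NA NB) * toC (ptMatrix NA NB) = 1 := by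
    rw [← toC_mul, ptMatrix_mul_self, toC_one]
  intro u v huv
  have := congrArg (fun z => toC (ptMatrix NA NB) *ᵥ z) huv
  simpa [mulVec_mulVec, h1] using this

lemma conj_ptMatrix_posSemidef {M : Matrix (BiCoord NA NB) (BiCoord NA NB) ℂ}
    (h : M.PosSemidef) : (toC (ptMatrix NA NB) * M * toC (ptMatrix NA NB)).PosSemidef := by
  nth_rewrite 1 [← toC_ptMatrix_conjTranspose]
  exact h.conjTranspose_mul_mul_same _

/-- The PPT condition, moved from `γ` to the symplectic form. -/
lemma ppt_iff {γ : Matrix (BiCoord NA NB) (BiCoord NA NB) ℝ} :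
    (toC (partialTranspose γ) - Complex.I • toC (biSympl NA NB)).PosSemidef ↔
      (toC γ - Complex.I • toC (directSum (-sympl NA) (sympl NB))).PosSemidef := by
  have key : toC (ptMatrix NA NB) * (toC γ - Complex.I • toC (directSum (-sympl NA) (sympl NB))) *
      toC (ptMatrix NA NB) = toC (partialTranspose γ) - Complex.I • toC (biSympl NA NB) := by
    rw [Matrix.mul_sub, Matrix.sub_mul, Matrix.mul_smul, Matrix.smul_mul]
    simp only [← toC_mul]
    congr 3
    rw [← ptMatrix_conj_biSympl]
    calc _ = (ptMatrix NA NB * ptMatrix NA NB) * biSympl NA NB *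
        (ptMatrix NA NB * ptMatrix NA NB) := by simp only [Matrix.mul_assoc]
      _ = _ := by rw [ptMatrix_mul_self, Matrix.one_mul, Matrix.mul_one]
  have hF : toC (ptMatrix NA NB) * toC (ptMatrix NA NB) = 1 := by
    rw [← toC_mul, ptMatrix_mul_self, toC_one]
  constructor <;> intro h
  · have := conj_ptMatrix_posSemidef h
    rw [← key] at this
    convert this using 1
    symm
    set F := toC (ptMatrix NA NB)
    set M := toC γ - Complex.I • toC (directSum (-sympl NA) (sympl NB))
    calc F * (F * M * F) * F = (F * F) * M * (F * F) := by simp only [Matrix.mul_assoc]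
      _ = M := by rw [hF, Matrix.one_mul, Matrix.mul_one]
  · rw [← key]
    exact conj_ptMatrix_posSemidef h

lemma posSemidef_fromBlocks_diagonal {m n : Type} [Fintype m] [Fintype n]
    {A : Matrix m m ℂ} {D : Matrix n n ℂ}
    (hA : A.PosSemidef) (hD : D.PosSemidef) : (fromBlocks A 0 0 D).PosSemidef := by
  refine .of_dotProduct_mulVec_nonneg ?_ fun x => ?_
  · rw [IsHermitian, fromBlocks_conjTranspose, hA.1, hD.1]; simp
  · rw [fromBlocks_mulVec]
    have h1 := hA.dotProduct_mulVec_nonneg (x ∘ Sum.inl)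
    have h2 := hD.dotProduct_mulVec_nonneg (x ∘ Sum.inr)
    simpa [dotProduct] using add_nonneg h1 h2

lemma toC_fromBlocks {m n : Type} (A : Matrix m m ℝ) (B : Matrix m n ℝ) (C : Matrix n m ℝ)
    (D : Matrix n n ℝ) : toC (fromBlocks A B C D) =
      fromBlocks (toC A) (B.map Complex.ofReal) (C.map Complex.ofReal) (toC D) := by
  simp [toC, fromBlocks_map]

lemma posSemidef_directSum_sub {σA γA : Matrix (Coord NA) (Coord NA) ℝ}
    {σB γB : Matrix (Coord NB) (Coord NB) ℝ}
    (hA : (toC γA - Complex.I • toC σA).PosSemidef)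
    (hB : (toC γB - Complex.I • toC σB).PosSemidef) :
    (toC (directSum γA γB) - Complex.I • toC (directSum σA σB)).PosSemidef := by
  have := posSemidef_fromBlocks_diagonal hA hB
  convert this using 1
  simp [directSum, toC_fromBlocks, fromBlocks_smul, sub_eq_add_neg, fromBlocks_neg, fromBlocks_add]

/-- γA dominates -iσ as well as iσ, so the sign of σ may be flipped on party A alone. -/
lemma ppt_of_mem_SepCMSet {γ : Matrix (BiCoord NA NB) (BiCoord NA NB) ℝ} (h : γ ∈ SepCMSet NA NB) :
    (toC γ - Complex.I • toC (directSum (-sympl NA) (sympl NB))).PosSemidef := by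
  obtain ⟨-, γA, γB, hA, hB, hle⟩ := h
  have h1 : (toC γA - Complex.I • toC (-sympl NA)).PosSemidef := by
    rw [toC_neg, smul_neg, sub_neg_eq_add]
    exact hA.uncertainty_pos
  have := (posSemidef_toC hle).add (posSemidef_directSum_sub h1 hB.uncertainty_neg)
  convert this using 1
  rw [toC_sub]
  abel

end Bipartite

end GaussianWitness

/-! ### Sufficiency of PPT for one mode against many, up to dilation -/

namespace GaussianWitness

open Matrix

lemma hermitian_eq_toC_add_I {n : Type} (M : Matrix n n ℂ) :
    M = toC (M.map Complex.re) + Complex.I • toC (M.map Complex.im) := by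
  ext i j
  simp [toC, mul_comm Complex.I]

/-- Real skew forms on a plane form a line. This is where the restriction of A to one mode is
essential. -/
lemma skew_oneMode (T : Matrix (Coord 1) (Coord 1) ℝ) (hT : Tᵀ = -T) :
    T = T (0, 0) (0, 1) • sympl 1 := by
  have h (p q : Coord 1) : T q p = -T p q := congrFun (congrFun hT p) q
  have h0 := h (0, 0) (0, 0)
  have h1 := h (0, 1) (0, 1)
  have h2 := h (0, 0) (0, 1)
  ext ⟨i, a⟩ ⟨j, b⟩
  obtain rfl := Subsingleton.elim i 0
  obtain rfl := Subsingleton.elim j 0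
  fin_cases a <;> fin_cases b <;> simp [sympl] <;> linarith

/-- Every one-mode Hermitian matrix that dominates `± iσ` dominates a one-mode covariance matrix. -/
lemma exists_oneMode_CM {M : Matrix (Coord 1) (Coord 1) ℂ}
    (h1 : (M + Complex.I • toC (sympl 1)).PosSemidef)
    (h2 : (M - Complex.I • toC (sympl 1)).PosSemidef) :
    ∃ γA, IsCM (sympl 1) γA ∧ (M - toC γA).PosSemidef := by
  have hσ := sympl_transpose 1
  have hMH : M.IsHermitian := by
    have := h1.1.sub (I_smul_isHermitian hσ)
    rwa [add_sub_cancel_right] at this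
  set R := M.map Complex.re with hR
  set τ := (M (0, 0) (0, 1)).im with hτ
  have hRs : R.IsSymm := by
    ext i j
    have := congrArg Complex.re (congrFun (congrFun hMH i) j)
    simpa [hR] using this
  have hT : M.map Complex.im = τ • sympl 1 := by
    refine skew_oneMode _ ?_
    ext i j
    have := congrArg Complex.im (congrFun (congrFun hMH i) j)
    simp only [conjTranspose_apply, Complex.star_def, Complex.conj_im] at this
    rw [neg_apply, transpose_apply, map_apply, map_apply]
    linarith
  have hM : M = toC R + Complex.I • toC (τ • sympl 1) := by
    rw [← hT]; exact hermitian_eq_toC_add_I M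
  -- Now M = R + iτσ, and the hypothesis with the sign of τ reads R ± ikσ ≥ 0; transposition gives
  -- the other sign. Hence R/k is a covariance matrix, and M - R/k is |τ|/k times one of the
  -- matrices R ± ikσ.
  set k := 1 + |τ| with hk
  have hk0 : 0 < k := by positivity
  have hkσ : (k • sympl 1)ᵀ = -(k • sympl 1) := by rw [transpose_smul, hσ, smul_neg]
  have hm : (toC R - Complex.I • toC (k • sympl 1)).PosSemidef := by
    rcases le_total 0 τ with h | h
    · rw [← posSemidef_add_iff_sub hRs hkσ]
      convert h1 using 1
      rw [hM, hk, abs_of_nonneg h, add_smul, one_smul, toC_add, smul_add]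
      abel
    · convert h2 using 1
      rw [hM, hk, abs_of_nonpos h, add_smul, one_smul, toC_add, smul_add, neg_smul, toC_neg,
        smul_neg]
      abel
  have hp := (posSemidef_add_iff_sub hRs hkσ).2 hm
  refine ⟨k⁻¹ • R, .of_sub hσ (hRs.smul _) ?_, ?_⟩
  · convert hm.smul (inv_pos.2 hk0).le using 1
    rw [toC_smul, toC_smul, smul_sub, smul_comm k⁻¹ Complex.I, smul_smul, inv_mul_cancel₀ hk0.ne',
      one_smul]
  · have hcoef : 1 - k⁻¹ = |τ| / k := by rw [hk]; field_simp; ring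
    rcases le_total 0 τ with h | h
    · convert hp.smul (show 0 ≤ |τ| / k by positivity) using 1
      rw [hM, toC_smul, toC_smul, toC_smul, smul_add, smul_comm (|τ| / k) Complex.I, smul_smul,
        div_mul_cancel₀ _ hk0.ne', ← hcoef, sub_smul, one_smul, abs_of_nonneg h]
      abel
    · convert hm.smul (show 0 ≤ |τ| / k by positivity) using 1
      rw [hM, toC_smul, toC_smul, toC_smul, smul_sub, smul_comm (|τ| / k) Complex.I, smul_smul,
        div_mul_cancel₀ _ hk0.ne', ← hcoef, sub_smul, one_smul, abs_of_nonpos h, neg_smul, smul_neg]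
      abel

variable {NA NB : ℕ}

lemma posDef_block₂₂ {m n : Type} [Finite m] [Finite n] {A : Matrix m m ℂ} {B : Matrix m n ℂ}
    {C : Matrix n m ℂ} {D : Matrix n n ℂ} (h : (fromBlocks A B C D).PosDef) : D.PosDef := by
  exact h.submatrix (e := (Sum.inr : n → m ⊕ n)) Sum.inr_injective

lemma posDef_block₁₁ {m n : Type} [Finite m] [Finite n] {A : Matrix m m ℂ} {B : Matrix m n ℂ}
    {C : Matrix n m ℂ} {D : Matrix n n ℂ} (h : (fromBlocks A B C D).PosDef) : A.PosDef := by
  exact h.submatrix (e := (Sum.inl : m → m ⊕ n)) Sum.inl_injective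

lemma map_conjTranspose {m n : Type} (X : Matrix m n ℝ) :
    Xᵀ.map Complex.ofReal = (X.map Complex.ofReal)ᴴ := by
  ext; simp

/-- A PPT state of one mode against `NB` modes dominates `γA ⊕ iσ_B`. -/
lemma exists_CM_left {A : Matrix (Coord 1) (Coord 1) ℝ} {X : Matrix (Coord 1) (Coord NB) ℝ}
    {B : Matrix (Coord NB) (Coord NB) ℝ}
    (h1 : (toC (fromBlocks A X Xᵀ B) - Complex.I • toC (biSympl 1 NB)).PosDef)
    (h2 : (toC (fromBlocks A X Xᵀ B) -
      Complex.I • toC (directSum (-sympl 1) (sympl NB))).PosSemidef) :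
    ∃ γA, IsCM (sympl 1) γA ∧
      (fromBlocks (toC A - toC γA) (X.map Complex.ofReal) (X.map Complex.ofReal)ᴴ
        (toC B - Complex.I • toC (sympl NB))).PosSemidef := by
  have e (s : Matrix (Coord 1) (Coord 1) ℝ) : toC (fromBlocks A X Xᵀ B) -
      Complex.I • toC (directSum s (sympl NB)) =
        fromBlocks (toC A - Complex.I • toC s) (X.map Complex.ofReal) (X.map Complex.ofReal)ᴴ
          (toC B - Complex.I • toC (sympl NB)) := by
    simp [directSum, toC_fromBlocks, fromBlocks_smul, sub_eq_add_neg, fromBlocks_neg,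
      fromBlocks_add, map_conjTranspose]
  rw [biSympl, e] at h1
  rw [e] at h2
  have hD := posDef_block₂₂ h1
  have : Invertible (toC B - Complex.I • toC (sympl NB)) := hD.isUnit.invertible
  -- Both hypotheses have the same B block, hence the same Schur complement term S; together they
  -- say that A - S dominates iσ and -iσ.
  set S := X.map Complex.ofReal * (toC B - Complex.I • toC (sympl NB))⁻¹ * (X.map Complex.ofReal)ᴴ with hS
  have h1' : (toC A - Complex.I • toC (sympl 1) - S).PosSemidef :=
    (PosDef.fromBlocks₂₂ _ _ hD).1 h1.posSemidef
  have h2' : (toC A - Complex.I • toC (-sympl 1) - S).PosSemidef :=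
    (PosDef.fromBlocks₂₂ _ _ hD).1 h2
  obtain ⟨γA, hγA, hle⟩ := exists_oneMode_CM (M := toC A - S)
    (by convert h2' using 1; rw [toC_neg, smul_neg]; abel) (by convert h1' using 1; abel)
  have hle' : (toC A - toC γA - S).PosSemidef := by
    convert hle using 1
    abel
  exact ⟨γA, hγA, (PosDef.fromBlocks₂₂ _ _ hD).2 hle'⟩

lemma toC_inv {n : Type} [Fintype n] [DecidableEq n] {A : Matrix n n ℝ} (hA : IsUnit A.det) :
    (toC A)⁻¹ = toC A⁻¹ := by
  refine inv_eq_right_inv ?_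
  rw [← toC_mul, mul_nonsing_inv _ hA, toC_one]

/-- The Schur complement gives the covariance matrix of the second party. -/
lemma exists_CM_right {A : Matrix (Coord NA) (Coord NA) ℝ} {X : Matrix (Coord NA) (Coord NB) ℝ}
    {B : Matrix (Coord NB) (Coord NB) ℝ} (hB : B.IsSymm)
    (h : (fromBlocks (toC A) (X.map Complex.ofReal) (X.map Complex.ofReal)ᴴ
        (toC B - Complex.I • toC (sympl NB))).PosDef) :
    ∃ γB, IsCM (sympl NB) γB ∧ (fromBlocks A X Xᵀ (B - γB)).PosSemidef := by
  have hA := posDef_block₁₁ h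
  have hAs : Aᵀ = A := by
    have := (posSemidef_of_toC hA.posSemidef).1
    rwa [IsHermitian, conjTranspose_eq_transpose_of_trivial] at this
  have hdet : IsUnit A.det := by
    have h1 : (toC A).det = (A.det : ℂ) := (Complex.ofRealHom.map_det A).symm
    have h2 := (isUnit_iff_isUnit_det _).1 hA.isUnit
    rw [h1, isUnit_iff_ne_zero] at h2
    exact isUnit_iff_ne_zero.2 (by exact_mod_cast h2)
  have : Invertible (toC A) := hA.isUnit.invertible
  have hS : toC (Xᵀ * A⁻¹ * X) = (X.map Complex.ofReal)ᴴ * (toC A)⁻¹ * X.map Complex.ofReal := by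
    rw [toC_inv hdet, ← map_conjTranspose]
    ext; simp [toC, mul_apply]
  have h1 : (toC B - Complex.I • toC (sympl NB) - toC (Xᵀ * A⁻¹ * X)).PosSemidef := by
    rw [hS]; exact (PosDef.fromBlocks₁₁ _ _ hA).1 h.posSemidef
  -- The largest choice that keeps the block matrix semidefinite; it is real because A and X are.
  refine ⟨B - Xᵀ * A⁻¹ * X, .of_sub (sympl_transpose NB) (hB.sub ?_) ?_, ?_⟩
  · rw [IsSymm, transpose_mul, transpose_mul, transpose_transpose, transpose_nonsing_inv, hAs,
      Matrix.mul_assoc]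
  · convert h1 using 1
    rw [toC_sub]
    abel
  · rw [sub_sub_cancel]
    refine posSemidef_of_toC ?_
    rw [toC_fromBlocks, map_conjTranspose, PosDef.fromBlocks₁₁ _ _ hA, hS, sub_self]
    exact .zero

lemma mem_SepCMSet_of_ppt_of_one_lt {γ : Matrix (BiCoord 1 NB) (BiCoord 1 NB) ℝ}
    (hγ : γ ∈ CMSet 1 NB)
    (h : (toC γ - Complex.I • toC (directSum (-sympl 1) (sympl NB))).PosSemidef)
    {t : ℝ} (ht : 1 < t) : t • γ ∈ SepCMSet 1 NB := by
  refine ⟨hγ.smul biSympl_transpose ht.le, ?_⟩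
  have hpd := hγ.posDef_toC biSympl_mul_self
  have hneg := hγ.uncertainty_neg
  have hs := hγ.symm
  obtain ⟨A, X, X', B, rfl⟩ : ∃ A X X' B, γ = fromBlocks A X X' B :=
    ⟨_, _, _, _, (fromBlocks_toBlocks γ).symm⟩
  obtain ⟨-, rfl, -, hB⟩ := isSymm_fromBlocks_iff.1 hs
  -- The dilation is spent in two halves: r - 1 makes the first elimination strict, t - r the
  -- second.
  set r := (1 + t) / 2 with hr
  have hr1 : 0 < r - 1 := by linarith
  have htr : 0 < t - r := by linarith
  have hadd (ω : Matrix (BiCoord 1 NB) (BiCoord 1 NB) ℝ) :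
      toC (r • fromBlocks A X Xᵀ B) - Complex.I • toC ω =
        (toC (fromBlocks A X Xᵀ B) - Complex.I • toC ω) +
          (r - 1) • toC (fromBlocks A X Xᵀ B) := by
    rw [toC_smul, sub_smul, one_smul]
    abel
  have hrb : r • fromBlocks A X Xᵀ B = fromBlocks (r • A) (r • X) (r • X)ᵀ (r • B) := by
    rw [fromBlocks_smul, transpose_smul]
  obtain ⟨γA, hγA, hle⟩ := exists_CM_left (A := r • A) (X := r • X) (B := r • B)
    (by rw [← hrb, hadd]; exact (hpd.smul hr1).posSemidef_add hneg)
    (by rw [← hrb, hadd]; exact h.add (hpd.smul hr1).posSemidef)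
  have hpos := (hpd.smul htr).posSemidef_add hle
  obtain ⟨γB, hγB, hle2⟩ := exists_CM_right (A := t • A - γA) (X := t • X) (B := t • B)
    (hB.smul t) (by
      convert hpos using 1
      rw [toC_fromBlocks, fromBlocks_smul, fromBlocks_add]
      congr 1
      · rw [toC_sub, toC_smul, toC_smul, sub_smul]; abel
      · ext; simp; ring
      · ext; simp; ring
      · rw [toC_smul, toC_smul, sub_smul]; abel)
  refine ⟨γA, γB, hγA, hγB, ?_⟩
  convert hle2 using 1
  simp [directSum, fromBlocks_smul, sub_eq_add_neg, fromBlocks_neg, fromBlocks_add]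

end GaussianWitness

/-! ### Removing the dilation by compactness -/

namespace GaussianWitness

open Matrix Filter Topology

lemma isClosed_posSemidef {n 𝕜 : Type} [Fintype n] [RCLike 𝕜] :
    IsClosed {M : Matrix n n 𝕜 | M.PosSemidef} := by
  simp only [posSemidef_iff_dotProduct_mulVec, Set.ofPred_and, Set.ofPred_forall]
  refine IsClosed.inter (isClosed_eq (by fun_prop) continuous_id) (isClosed_iInter fun x => ?_)
  exact isClosed_le continuous_const (by fun_prop)

lemma continuous_toC {n : Type} : Continuous (toC : Matrix n n ℝ → Matrix n n ℂ) :=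
  continuous_id.matrix_map Complex.continuous_ofReal

lemma isClosed_isCM {n : Type} [Fintype n] {σ : Matrix n n ℝ} (hσ : σᵀ = -σ) :
    IsClosed {γ : Matrix n n ℝ | IsCM σ γ} := by
  have : {γ : Matrix n n ℝ | IsCM σ γ} =
      {γ | γ.IsSymm} ∩ {γ | (toC γ - Complex.I • toC σ).PosSemidef} :=
    Set.ext fun γ => ⟨fun h => ⟨h.symm, h.uncertainty_neg⟩, fun h => .of_sub hσ h.1 h.2⟩
  rw [this]
  exact IsClosed.inter (isClosed_eq (by fun_prop) continuous_id)
    (isClosed_posSemidef.preimage (continuous_toC.sub continuous_const))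

/-- For a Gram matrix this is 2|xy| ≤ x² + y² summed over the components. It reduces boundedness to
the diagonal. -/
lemma abs_apply_le_of_posSemidef {n : Type} [Fintype n] {M : Matrix n n ℝ} (hM : M.PosSemidef)
    (i j : n) : |M i j| ≤ (M i i + M j j) / 2 := by
  classical
  open scoped MatrixOrder in
  obtain ⟨B, rfl⟩ := CStarAlgebra.nonneg_iff_eq_star_mul_self.mp hM.nonneg
  simp only [mul_apply, star_apply, star_trivial]
  rw [← Finset.sum_add_distrib, Finset.sum_div]
  refine (Finset.abs_sum_le_sum_abs _ _).trans (Finset.sum_le_sum fun k _ => abs_le.2 ⟨?_, ?_⟩)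
  · nlinarith [sq_nonneg (B k i + B k j)]
  · nlinarith [sq_nonneg (B k i - B k j)]

lemma directSum_posSemidef {NA NB : ℕ} {γA : Matrix (Coord NA) (Coord NA) ℝ}
    {γB : Matrix (Coord NB) (Coord NB) ℝ} (hA : γA.PosSemidef) (hB : γB.PosSemidef) :
    (directSum γA γB).PosSemidef := by
  refine posSemidef_of_toC ?_
  rw [directSum, toC_fromBlocks]
  convert posSemidef_fromBlocks_diagonal (posSemidef_toC hA) (posSemidef_toC hB) using 2 <;> simp

/-- A covariance matrix is separable if all its strict dilations are. -/
lemma mem_SepCMSet_of_forall_one_lt {NA NB : ℕ} {γ : Matrix (BiCoord NA NB) (BiCoord NA NB) ℝ}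
    (hγ : γ ∈ CMSet NA NB) (h : ∀ t : ℝ, 1 < t → t • γ ∈ SepCMSet NA NB) :
    γ ∈ SepCMSet NA NB := by
  let r : ℕ → ℝ := fun k => 1 + 1 / ((k : ℝ) + 1)
  have hr1 (k : ℕ) : 1 < r k := by
    have : 0 < 1 / ((k : ℝ) + 1) := by positivity
    simp only [r]; linarith
  have hr2 (k : ℕ) : r k ≤ 2 := by
    have : 1 / ((k : ℝ) + 1) ≤ 1 := by
      rw [div_le_one (by positivity)]; linarith [(Nat.cast_nonneg k : (0 : ℝ) ≤ k)]
    simp only [r]; linarith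
  have hr : Tendsto r atTop (𝓝 1) := by
    simpa [r] using tendsto_one_div_add_atTop_nhds_zero_nat.const_add (1 : ℝ)
  choose γA γB hA hB hle using fun k => (h (r k) (hr1 k)).2
  let G : ℕ → Matrix (BiCoord NA NB) (BiCoord NA NB) ℝ := fun k => directSum (γA k) (γB k)
  have hG (k : ℕ) : (G k).PosSemidef := directSum_posSemidef (hA k).nonneg (hB k).nonneg
  -- The product states lie below r_k γ ≤ 2γ, so they stay in a compact box.
  have hdiag (k : ℕ) (i) : G k i i ≤ 2 * γ i i := by
    have h1 := (hle k).diag_nonneg (i := i)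
    have h2 := hγ.nonneg.diag_nonneg (i := i)
    rw [Matrix.sub_apply, Matrix.smul_apply, smul_eq_mul] at h1
    nlinarith [hr2 k]
  have hmem (k : ℕ) : G k ∈ Set.univ.pi fun i => Set.univ.pi fun j =>
      Set.Icc (-(γ i i + γ j j)) (γ i i + γ j j) := by
    intro i _ j _
    have h1 := abs_apply_le_of_posSemidef (hG k) i j
    rw [Set.mem_Icc, ← abs_le]
    linarith [hdiag k i, hdiag k j]
  obtain ⟨L, φ, hφ, hL⟩ : ∃ (L : Matrix (BiCoord NA NB) (BiCoord NA NB) ℝ) (φ : ℕ → ℕ),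
      StrictMono φ ∧ Tendsto (G ∘ φ) atTop (𝓝 L) := by
    obtain ⟨L, -, φ, hφ, hL⟩ := (isCompact_univ_pi fun i => isCompact_univ_pi fun j =>
      isCompact_Icc).tendsto_subseq hmem
    exact ⟨L, φ, hφ, hL⟩
  have hL11 : IsCM (sympl NA) L.toBlocks₁₁ :=
    (isClosed_isCM (sympl_transpose NA)).mem_of_tendsto
      ((Continuous.tendsto (f := fun M : Matrix (BiCoord NA NB) (BiCoord NA NB) ℝ =>
        M.toBlocks₁₁) (by unfold toBlocks₁₁; fun_prop) L).comp hL)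
      (Eventually.of_forall fun k => by simpa [G, directSum] using hA (φ k))
  have hL22 : IsCM (sympl NB) L.toBlocks₂₂ :=
    (isClosed_isCM (sympl_transpose NB)).mem_of_tendsto
      ((Continuous.tendsto (f := fun M : Matrix (BiCoord NA NB) (BiCoord NA NB) ℝ =>
        M.toBlocks₂₂) (by unfold toBlocks₂₂; fun_prop) L).comp hL)
      (Eventually.of_forall fun k => by simpa [G, directSum] using hB (φ k))
  have hLeq : L = directSum L.toBlocks₁₁ L.toBlocks₂₂ := by
    have hcl : IsClosed {M : Matrix (BiCoord NA NB) (BiCoord NA NB) ℝ |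
        M = directSum M.toBlocks₁₁ M.toBlocks₂₂} :=
      isClosed_eq continuous_id (by unfold directSum toBlocks₁₁ toBlocks₂₂; fun_prop)
    exact hcl.mem_of_tendsto hL (Eventually.of_forall fun k => by simp [G, directSum])
  refine ⟨hγ, L.toBlocks₁₁, L.toBlocks₂₂, hL11, hL22, ?_⟩
  rw [← hLeq]
  have hlim : Tendsto (fun k => r (φ k) • γ - G (φ k)) atTop (𝓝 (γ - L)) := by
    simpa using ((hr.comp hφ.tendsto_atTop).smul_const γ).sub hL
  exact isClosed_posSemidef.mem_of_tendsto hlim (Eventually.of_forall fun k => hle (φ k))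

/-- The PPT criterion for one mode against `NB` modes. -/
theorem pptNecessaryAndSufficient_one (NB : ℕ) : PPTNecessaryAndSufficient 1 NB := by
  intro γ hγ
  rw [posSemidef_add_iff_sub (partialTranspose_isSymm hγ.symm) biSympl_transpose, ppt_iff]
  exact ⟨ppt_of_mem_SepCMSet, fun h => mem_SepCMSet_of_forall_one_lt hγ fun t ht =>
    mem_SepCMSet_of_ppt_of_one_lt hγ h ht⟩

/-! ### Lower bounds on outcomes and attained outcomes -/

section Negativity

variable {NA NB : ℕ}

lemma mem_SepCMSet_of_symplEigenvalues (hppt : PPTNecessaryAndSufficient NA NB)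
    {γ : Matrix (BiCoord NA NB) (BiCoord NA NB) ℝ} (hγ : γ ∈ CMSet NA NB) {s : ℝ} (hs : 0 < s)
    (h1 : ∀ x ∈ symplEigenvalues (biSympl NA NB) γ, s ≤ x)
    (h2 : ∀ x ∈ ptEigenvalues γ, s ≤ x) : s⁻¹ • γ ∈ SepCMSet NA NB := by
  have hpd := hγ.posDef_toC biSympl_mul_self
  have hcm : s⁻¹ • γ ∈ CMSet NA NB := .of_sub biSympl_transpose (hγ.symm.smul _)
    (posSemidef_of_symplEigenvalues biSympl_transpose biSympl_mul_self hpd hs h1)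
  rw [hppt _ hcm, posSemidef_add_iff_sub (partialTranspose_isSymm hcm.symm) biSympl_transpose,
    partialTranspose_smul]
  exact posSemidef_of_symplEigenvalues biSympl_transpose biSympl_mul_self
    (partialTranspose_posDef hpd) hs h2

lemma le_outcome (hppt : PPTNecessaryAndSufficient NA NB)
    {γ : Matrix (BiCoord NA NB) (BiCoord NA NB) ℝ} (hγ : γ ∈ CMSet NA NB) {s : ℝ} (hs : 0 < s)
    (h1 : ∀ x ∈ symplEigenvalues (biSympl NA NB) γ, s ≤ x) (h2 : ∀ x ∈ ptEigenvalues γ, s ≤ x)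
    {Z : Matrix (BiCoord NA NB) (BiCoord NA NB) ℝ} (hZ : Z ∈ witnesses NA NB) :
    s ≤ (Z * γ).trace := by
  have h := hZ.2 _ (mem_SepCMSet_of_symplEigenvalues hppt hγ hs h1 h2)
  rw [smul_mul_assoc, trace_smul, trace_mul_comm, smul_eq_mul] at h
  rwa [inv_mul_eq_div, one_le_div hs] at h

lemma one_le_symplEigenvalue_of_mem_CMSet {γ : Matrix (BiCoord NA NB) (BiCoord NA NB) ℝ}
    (hγ : γ ∈ CMSet NA NB) {x : ℝ} (hx : x ∈ symplEigenvalues (biSympl NA NB) γ) : 1 ≤ x :=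
  one_le_symplEigenvalue biSympl_transpose biSympl_mul_self hγ hx

lemma neg_log_le_logNegativity {γ : Matrix (BiCoord NA NB) (BiCoord NA NB) ℝ} {x : ℝ}
    (hx : x ∈ ptEigenvalues γ) : -Real.log x ≤ logNegativity γ := by
  obtain ⟨s, hs⟩ := Multiset.exists_cons_of_mem hx
  rw [logNegativity, hs, Multiset.map_cons, Multiset.sum_cons]
  have h : (s.map fun x => min (Real.log x) 0).sum ≤ 0 :=
    (Multiset.sum_le_card_nsmul _ 0 (by simp)).trans (by simp)
  linarith [min_le_left (Real.log x) 0]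

theorem log_one_div_le_logNegativity (hppt : PPTNecessaryAndSufficient NA NB)
    {γ : Matrix (BiCoord NA NB) (BiCoord NA NB) ℝ} (hγ : γ ∈ CMSet NA NB)
    {Z : Matrix (BiCoord NA NB) (BiCoord NA NB) ℝ} (hZ : Z ∈ witnesses NA NB) {m : ℝ}
    (hm : (Z * γ).trace = m) (h0 : 0 < m) (h1 : m < 1) :
    Real.log (1 / m) ≤ logNegativity γ := by
  by_cases h : ∃ x ∈ ptEigenvalues γ, x ≤ m
  · obtain ⟨x, hx, hxm⟩ := h
    refine le_trans ?_ (neg_log_le_logNegativity hx)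
    rw [one_div, Real.log_inv, neg_le_neg_iff]
    exact Real.log_le_log (mem_symplEigenvalues_iff.1 hx).1 hxm
  · push Not at h
    -- Including 1 keeps s below the symplectic eigenvalues of γ itself, and makes the finite set
    -- nonempty.
    obtain ⟨s, hs, hmin⟩ := (insert 1 (ptEigenvalues γ).toFinset).exists_min_image id
      ⟨1, Finset.mem_insert_self _ _⟩
    have hms : m < s := by
      rcases Finset.mem_insert.1 hs with rfl | hs
      · exact h1
      · exact h s (Multiset.mem_toFinset.1 hs)
    have hs1 : s ≤ 1 := hmin 1 (Finset.mem_insert_self _ _)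
    have := le_outcome hppt hγ (h0.trans hms)
      (fun x hx => hs1.trans (one_le_symplEigenvalue_of_mem_CMSet hγ hx))
      (fun x hx => hmin x (Finset.mem_insert_of_mem (Multiset.mem_toFinset.2 hx))) hZ
    linarith

/-- Every separable matrix obeys the uncertainty relation, so the eigenvector witnesses of γ itself
qualify. They are needed for the minimum to exist when γ is separable. -/
lemma mem_outcomes_of_symplEigenvalue {γ : Matrix (BiCoord NA NB) (BiCoord NA NB) ℝ}
    (hγ : γ ∈ CMSet NA NB) {x : ℝ} (hx : x ∈ symplEigenvalues (biSympl NA NB) γ) :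
    x ∈ outcomes γ := by
  obtain ⟨Z, hZ, hx, h⟩ := exists_vectorWitness biSympl_transpose biSympl_mul_self
    (hγ.posDef_toC biSympl_mul_self) hx
  exact ⟨Z, ⟨hZ, fun B hB => h B hB.1.uncertainty_neg⟩, by rw [← hx, trace_mul_comm]⟩

/-- Partial transposition is self-adjoint for the trace pairing, so the eigenvector witness of the
partial transpose can be transposed back; it bounds separable matrices because they are PPT. -/
lemma mem_outcomes_of_ptEigenvalue {γ : Matrix (BiCoord NA NB) (BiCoord NA NB) ℝ}
    (hγ : γ ∈ CMSet NA NB) {x : ℝ} (hx : x ∈ ptEigenvalues γ) :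
    x ∈ outcomes γ := by
  obtain ⟨Z, hZ, hx, h⟩ := exists_vectorWitness biSympl_transpose biSympl_mul_self
    (partialTranspose_posDef (hγ.posDef_toC biSympl_mul_self)) hx
  have htr (B : Matrix (BiCoord NA NB) (BiCoord NA NB) ℝ) :
      (partialTranspose B * Z).trace = (B * partialTranspose Z).trace := by
    simp only [partialTranspose]
    rw [Matrix.mul_assoc, Matrix.mul_assoc, trace_mul_comm]
    simp only [Matrix.mul_assoc]
  refine ⟨partialTranspose Z, ⟨partialTranspose_isSymm hZ, fun B hB => ?_⟩, ?_⟩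
  · rw [← htr]
    exact h _ (ppt_iff.2 (ppt_of_mem_SepCMSet hB))
  · rw [trace_mul_comm, ← htr, hx]

end Negativity

end GaussianWitness

/-! ### Two modes: the minimal outcome -/

namespace GaussianWitness

open Matrix

section TwoModes

variable {n : Type} [Fintype n] [DecidableEq n]

/-- The transpose of iσA is -iAσ, which has the characteristic polynomial of -iσA. The spectrum is
thus symmetric about 0; even dimension removes the sign. -/
lemma charpoly_comp_neg_X {σ A : Matrix n n ℝ} (hσ : σᵀ = -σ) (hA : A.IsSymm)
    (hn : Even (Fintype.card n)) :
    (Complex.I • toC (σ * A)).charpoly.comp (-Polynomial.X) =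
      (Complex.I • toC (σ * A)).charpoly := by
  set M := Complex.I • toC (σ * A) with hM
  have h1 : (-M).charpoly = M.charpoly := by
    have hT : Mᵀ = (Complex.I • toC A) * (-toC σ) := by
      rw [hM, transpose_smul, ← toC_transpose, transpose_mul, hA.eq, hσ, toC_mul, toC_neg,
        smul_mul_assoc]
    have hN : -M = (-toC σ) * (Complex.I • toC A) := by
      rw [hM, toC_mul, Matrix.neg_mul, Matrix.mul_smul]
    rw [← charpoly_transpose M, hT, hN, charpoly_mul_comm]
  rw [← h1]
  refine Polynomial.funext fun z => ?_
  conv_lhs => rw [h1]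
  rw [Polynomial.eval_comp, eval_charpoly, eval_charpoly, Polynomial.eval_neg, Polynomial.eval_X,
    ← neg_neg (scalar n (-z) - M), det_neg, hn.neg_one_pow, one_mul]
  congr 1
  rw [map_neg]
  abel

/-- On two modes there are two symplectic eigenvalues, and they determine the determinant. -/
lemma symplEigenvalues_eq_pair {σ A : Matrix n n ℝ} (hσ : σᵀ = -σ) (hσ2 : σ * σ = -1)
    (hdet : σ.det = 1) (hn : Fintype.card n = 4) (hAs : A.IsSymm) (hA : (toC A).PosDef) :
    ∃ a b : ℝ, 0 < a ∧ 0 < b ∧ symplEigenvalues σ A = {a, b} ∧ A.det = (a * b) ^ 2 := by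
  classical
  set M := Complex.I • toC (σ * A) with hM
  set R := M.charpoly.roots with hR
  have hneg : R.map (fun z => -z) = R := by
    rw [hR, ← Polynomial.roots_comp_neg_X, charpoly_comp_neg_X hσ hAs (by rw [hn]; decide)]
  have hcard : R.card = 4 := by
    rw [hR, ← hn, ← charpoly_natDegree_eq_dim M]
    exact ((Polynomial.splits_iff_card_roots).1 (IsAlgClosed.splits _))
  set P := R.filter (fun z => 0 < z) with hP
  -- No root vanishes, so the non-positive roots are exactly the negatives of the positive ones.
  have hcompl : R.filter (fun z => ¬ 0 < z) = P.map (fun z => -z) := by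
    conv_lhs => rw [← hneg]
    rw [Multiset.filter_map, hP]
    congr 1
    refine Multiset.filter_congr fun z hz => ?_
    obtain ⟨x, rfl, hx0, -⟩ := root_real hσ hσ2 hA hz
    simp only [Function.comp_apply, ← Complex.ofReal_neg, Complex.zero_lt_real]
    constructor
    · intro h; exact lt_of_le_of_ne (by linarith) hx0.symm
    · intro h; linarith
  have hsplit : P + P.map (fun z => -z) = R := by
    rw [← hcompl]; exact Multiset.filter_add_not _ _
  have hP2 : P.card = 2 := by
    have := congrArg Multiset.card hsplit
    rw [Multiset.card_add, Multiset.card_map, hcard] at this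
    omega
  obtain ⟨z, w, hzw⟩ := Multiset.card_eq_two.1 hP2
  have hre (u : ℂ) (hu : u ∈ P) : 0 < u.re ∧ (u.re : ℂ) = u := by
    obtain ⟨h1, h2⟩ := Complex.pos_iff.1 (Multiset.mem_filter.1 hu).2
    exact ⟨h1, Complex.ext rfl (by simpa using h2)⟩
  obtain ⟨hz0, hz⟩ := hre z (by simp [hzw])
  obtain ⟨hw0, hw⟩ := hre w (by simp [hzw])
  refine ⟨z.re, w.re, hz0, hw0, ?_, ?_⟩
  · have : symplEigenvalues σ A = P.map Complex.re := by
      unfold symplEigenvalues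
      congr!
    rw [this, hzw]
    simp
  · have h1 : M.det = A.det := by
      have : (toC (σ * A)).det = ((σ * A).det : ℂ) := (Complex.ofRealHom.map_det _).symm
      rw [hM, det_smul, hn, this, det_mul, hdet, one_mul, Complex.I_pow_four, one_mul]
    have h2 : M.det = (z * w) ^ 2 := by
      rw [det_eq_prod_roots_charpoly, ← hR, ← hsplit, hzw]
      simp
      ring
    rw [h1, ← hz, ← hw] at h2
    exact_mod_cast h2

end TwoModes

lemma exists_isLeast_outcomes {γ : Matrix (BiCoord 1 1) (BiCoord 1 1) ℝ} (hγ : γ ∈ CMSet 1 1) :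
    ((ptEigenvalues γ).filter (fun x => x < 1)).card ≤ 1 ∧
      ∃ m_min : ℝ, IsLeast (outcomes γ) m_min ∧
        (γ ∉ SepCMSet 1 1 → 0 < m_min ∧ m_min < 1 ∧
          IsLeast {x : ℝ | x ∈ ptEigenvalues γ} m_min ∧
          logNegativity γ = Real.log (1 / m_min)) := by
  have hppt := pptNecessaryAndSufficient_one 1
  have hpd := hγ.posDef_toC biSympl_mul_self
  obtain ⟨c, d, hc, hd, hcd, hdet1⟩ := symplEigenvalues_eq_pair biSympl_transpose biSympl_mul_self
    det_biSympl (by simp) hγ.symm hpd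
  obtain ⟨a, b, ha, hb, hab, hle, hdet2⟩ : ∃ a b : ℝ, 0 < a ∧ 0 < b ∧
      ptEigenvalues γ = {a, b} ∧ a ≤ b ∧ γ.det = (a * b) ^ 2 := by
    obtain ⟨a, b, ha, hb, hab, hdet2⟩ := symplEigenvalues_eq_pair biSympl_transpose
      biSympl_mul_self det_biSympl (by simp) (partialTranspose_isSymm hγ.symm)
      (partialTranspose_posDef hpd)
    rw [det_partialTranspose] at hdet2
    rcases le_total a b with h | h
    · exact ⟨a, b, ha, hb, hab, h, hdet2⟩
    · exact ⟨b, a, hb, ha, by rw [Multiset.pair_comm, ← hab]; rfl, h, by rw [hdet2, mul_comm]⟩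
  have hc1 : 1 ≤ c := one_le_symplEigenvalue_of_mem_CMSet hγ (by simp [hcd])
  have hd1 : 1 ≤ d := one_le_symplEigenvalue_of_mem_CMSet hγ (by simp [hcd])
  -- Partial transposition preserves the determinant, so ab = cd.
  have hab1 : 1 ≤ a * b := by
    rw [hdet1] at hdet2
    have : c * d = a * b := (pow_left_inj₀ (by positivity) (by positivity) two_ne_zero).1 hdet2
    nlinarith
  have hb1 : 1 ≤ b := by
    by_contra! h
    nlinarith
  have hmem {x : ℝ} : x ∈ ptEigenvalues γ ↔ x = a ∨ x = b := by simp [hab]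
  have hmem' {x : ℝ} : x ∈ symplEigenvalues (biSympl 1 1) γ ↔ x = c ∨ x = d := by simp [hcd]
  -- Since a ≤ b, this is the smallest eigenvalue in both spectra, and so both a lower bound and an
  -- attained outcome. For entangled γ it equals a, because a < 1 ≤ c, d.
  refine ⟨?_, min a (min c d), ⟨?_, ?_⟩, fun hent => ?_⟩
  · rw [hab, Multiset.insert_eq_cons, Multiset.filter_cons, Multiset.filter_singleton,
      if_neg hb1.not_gt]
    split_ifs <;> simp
  · rcases min_choice a (min c d) with h | h <;> rw [h]
    · exact mem_outcomes_of_ptEigenvalue hγ (hmem.2 (.inl rfl))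
    · exact mem_outcomes_of_symplEigenvalue hγ (hmem'.2 (min_choice c d))
  · rintro _ ⟨Z, hZ, rfl⟩
    refine le_outcome hppt hγ (by positivity) ?_ ?_ hZ
    · intro x hx
      rcases hmem'.1 hx with rfl | rfl <;> simp
    · intro x hx
      rcases hmem.1 hx with rfl | rfl
      · simp
      · exact (min_le_left _ _).trans hle
  · have ha1 : a < 1 := by
      by_contra! h
      refine hent ?_
      have := mem_SepCMSet_of_symplEigenvalues hppt hγ one_pos
        (fun x hx => one_le_symplEigenvalue_of_mem_CMSet hγ hx) (fun x hx => by
          rcases hmem.1 hx with rfl | rfl <;> assumption)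
      simpa using this
    have hmin : min a (min c d) = a := min_eq_left (ha1.le.trans (le_min hc1 hd1))
    rw [hmin]
    refine ⟨ha, ha1, ⟨hmem.2 (.inl rfl), fun x hx => ?_⟩, ?_⟩
    · rcases hmem.1 hx with rfl | rfl
      · exact le_rfl
      · exact hle
    · rw [logNegativity, hab]
      simp [min_eq_left (Real.log_nonpos ha.le ha1.le), min_eq_right (Real.log_nonneg hb1)]

end GaussianWitness

theorem mainTheorem1 :
    -- the lower bound, in every system where the PPT criterion is necessary and sufficient
    (∀ NA NB : ℕ, GaussianWitness.PPTNecessaryAndSufficient NA NB →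
      ∀ γ ∈ GaussianWitness.CMSet NA NB, ∀ Z ∈ GaussianWitness.witnesses NA NB, ∀ m : ℝ,
        (Z * γ).trace = m → 0 < m → m < 1 →
          Real.log (1 / m) ≤ GaussianWitness.logNegativity γ) ∧
    -- the lower bound, unconditionally, for one mode against `NB` modes
    (∀ NB : ℕ,
      ∀ γ ∈ GaussianWitness.CMSet 1 NB, ∀ Z ∈ GaussianWitness.witnesses 1 NB, ∀ m : ℝ,
        (Z * γ).trace = m → 0 < m → m < 1 →
          Real.log (1 / m) ≤ GaussianWitness.logNegativity γ) ∧
    -- two modes: the minimal outcome gives the logarithmic negativity of an entangled `γ`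
    (∀ γ ∈ GaussianWitness.CMSet 1 1,
      ((GaussianWitness.ptEigenvalues γ).filter (fun x => x < 1)).card ≤ 1 ∧
      ∃ m_min : ℝ, IsLeast (GaussianWitness.outcomes γ) m_min ∧
        (γ ∉ GaussianWitness.SepCMSet 1 1 →
          0 < m_min ∧ m_min < 1 ∧
          IsLeast {x : ℝ | x ∈ GaussianWitness.ptEigenvalues γ} m_min ∧
          GaussianWitness.logNegativity γ = Real.log (1 / m_min))) := by
  refine ⟨fun NA NB hppt γ hγ Z hZ m hm h0 h1 => ?_, fun NB γ hγ Z hZ m hm h0 h1 => ?_,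
    fun γ hγ => GaussianWitness.exists_isLeast_outcomes hγ⟩
  · exact GaussianWitness.log_one_div_le_logNegativity hppt hγ hZ hm h0 h1
  · exact GaussianWitness.log_one_div_le_logNegativity
      (GaussianWitness.pptNecessaryAndSufficient_one NB) hγ hZ hm h0 h1
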